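/- Call a real polynomial hyperbolic if all of its complex zeros are real; the zero polynomial is also deemed hyperbolic. A linear operator $T:\mathbb{R}[x]\to\mathbb{R}[x]$ preserves hyperbolicity if $T[f]$ is hyperbolic whenever $f$ is hyperbolic. Let $P_n(x)=\frac{1}{2^n n!}\frac{d^n}{dx^n}(x^2-1)^n$, $n=0,1,2,\dots$, be the Legendre polynomials, which form a basis of $\mathbb{R}[x]$. A sequence of real numbers $\{a_n\}_{n\ge 0}$ is a Legendre multiplier sequence if there is a hyperbolicity preserving linear operator $T:\mathbb{R}[x]\to\mathbb{R}[x]$ such that $T[P_n]=a_nP_n$ for every $n\ge 0$. **Theorem.** Let $A,B\in\mathbb{R}$ with $A\neq 0$. Then $\{An(n+1)+B\}_{n=0}^{\infty}$ is a Legendre multiplier sequence if and only if $$0\le \frac{B}{A}\le 1 .$$ -/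

import Mathlib

open Polynomial

/-- A real polynomial is hyperbolic if all its complex zeros are real; the zero polynomial is
hyperbolic by convention. -/
def IsHyperbolic (f : ℝ[X]) : Prop :=
  f = 0 ∨ ∀ z : ℂ, aeval z f = 0 → z.im = 0

/-- A linear operator on real polynomials preserves hyperbolicity if it maps hyperbolic
polynomials to hyperbolic polynomials. -/
def PreservesHyperbolicity (T : ℝ[X] →ₗ[ℝ] ℝ[X]) : Prop :=
  ∀ f : ℝ[X], IsHyperbolic f → IsHyperbolic (T f)

/-- A real sequence `a` is a `P`-multiplier sequence, for a basis `P` of the space of real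
polynomials, if some hyperbolicity preserver `T` satisfies `T (P n) = a n • P n` for every `n`. -/
def IsMultiplierSequence (P : Module.Basis ℕ ℝ ℝ[X]) (a : ℕ → ℝ) : Prop :=
  ∃ T : ℝ[X] →ₗ[ℝ] ℝ[X], PreservesHyperbolicity T ∧ ∀ n : ℕ, T (P n) = a n • P n

/-- The `n`-th Legendre polynomial `(1 / (2 ^ n n!)) D ^ n (x ^ 2 - 1) ^ n` (Rodrigues' formula). -/
noncomputable def legendrePoly (n : ℕ) : ℝ[X] :=
  C (1 / (2 ^ n * (n.factorial : ℝ))) * derivative^[n] ((X ^ 2 - 1) ^ n)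

theorem degree_legendrePoly (n : ℕ) : (legendrePoly n).degree = n := by
  have hm : (X ^ 2 - 1 : ℝ[X]).Monic := by
    simpa using monic_X_pow_sub_C (1 : ℝ) (n := 2) (by norm_num)
  have hd : (X ^ 2 - 1 : ℝ[X]).natDegree = 2 := by
    simpa using natDegree_X_pow_sub_C (n := 2) (r := (1 : ℝ))
  have hN : ((X ^ 2 - 1 : ℝ[X]) ^ n).natDegree = n + n := by
    rw [hm.natDegree_pow, hd]; ring
  have hc : ((X ^ 2 - 1 : ℝ[X]) ^ n).coeff (n + n) = 1 := by
    rw [← hN]; exact (hm.pow n).coeff_natDegree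
  have h0 : (1 / (2 ^ n * (n.factorial : ℝ))) ≠ 0 := by positivity
  rw [legendrePoly, degree_C_mul h0]
  apply le_antisymm
  · refine degree_le_natDegree.trans ?_
    have := natDegree_iterate_derivative ((X ^ 2 - 1 : ℝ[X]) ^ n) n
    rw [hN, Nat.add_sub_cancel] at this
    exact_mod_cast this
  · apply le_degree_of_ne_zero
    rw [coeff_iterate_derivative, hc, nsmul_eq_mul, mul_one]
    have : 0 < (n + n).descFactorial n := Nat.pos_of_ne_zero (by
      rw [Ne, Nat.descFactorial_eq_zero_iff_lt]; omega)
    exact_mod_cast this.ne'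

/-- The Legendre polynomials as a sequence of polynomials with `n`-th member of degree `n`. -/
noncomputable def legendreSequence : Polynomial.Sequence ℝ where
  elems' := legendrePoly
  degree_eq' := degree_legendrePoly

/-- The Legendre polynomials as a basis of the space of real polynomials. -/
noncomputable def legendreBasis : Module.Basis ℕ ℝ ℝ[X] :=
  legendreSequence.basis fun n =>
    (leadingCoeff_ne_zero.mpr (legendreSequence.ne_zero n)).isUnit

theorem legendreBasis_apply (n : ℕ) : legendreBasis n = legendrePoly n :=
  legendreSequence.basis_eq_self _ n

/-! Legendre's equation makes `P_n` an eigenvector of `(x² - 1)D² + 2xD` with eigenvalue `n(n+1)`. A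
multiplier operator is determined on the basis, so everything reduces to `T = (x² - 1)D² + 2xD + c`,
`c = B/A`.

If `0 ≤ c ≤ 1`, fix `z` in the upper half plane. Both roots `α`, `β` of the symbol `(z² - 1)y² + 2zy
+ c` have nonnegative imaginary part, and `T f` at `z` equals `(z² - 1)(D - β)(D - α)f` at `z`, with
`α`, `β` frozen. Each factor keeps the upper half plane zero-free; conjugation handles the lower
one.

Otherwise explicit hyperbolic polynomials acquire a quadratic factor of negative discriminant: `(x -
r)^n` with `n`, `r` large if `c > 1`, and `x² - r²` or a cubic if `c < 0`. -/

noncomputable section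

/-! ### Legendre's equation and reduction to one operator -/

/-- The differential operator `f ↦ (x ^ 2 - 1) f'' + 2 x f' + c f`. -/
def legendreOperator (c : ℝ) : ℝ[X] →ₗ[ℝ] ℝ[X] :=
  LinearMap.mulLeft ℝ (X ^ 2 - 1 : ℝ[X]) ∘ₗ derivative ∘ₗ derivative +
    LinearMap.mulLeft ℝ (2 * X : ℝ[X]) ∘ₗ derivative + LinearMap.mulLeft ℝ (C c)

theorem legendreOperator_apply (c : ℝ) (f : ℝ[X]) :
    legendreOperator c f =
      (X ^ 2 - 1) * derivative (derivative f) + 2 * X * derivative f + C c * f := rfl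

/-- Differentiate the first-order equation of `u = (x² - 1)^n` `k + 1` times; `k = n` yields
Legendre's equation. -/
theorem iterate_derivative_of_sq_sub_one_mul_derivative {n : ℕ} {u : ℝ[X]}
    (hu : (X ^ 2 - 1) * derivative u = 2 * (n : ℝ[X]) * X * u) (k : ℕ) :
    (X ^ 2 - 1) * derivative^[k + 2] u + 2 * ((k : ℝ[X]) + 1) * X * derivative^[k + 1] u +
      (k : ℝ[X]) * ((k : ℝ[X]) + 1) * derivative^[k] u =
    2 * (n : ℝ[X]) * X * derivative^[k + 1] u +
      2 * (n : ℝ[X]) * ((k : ℝ[X]) + 1) * derivative^[k] u := by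
  induction k with
  | zero =>
    have h := congrArg derivative hu
    simp only [derivative_mul, derivative_sub, derivative_X_pow, derivative_one, derivative_X,
      derivative_natCast, derivative_ofNat, Nat.cast_ofNat, map_ofNat] at h
    simp only [Function.iterate_succ', Function.iterate_zero, Function.comp_apply, id]
    push_cast
    linear_combination h
  | succ k ih =>
    have h := congrArg derivative ih
    simp only [derivative_mul, derivative_add, derivative_sub, derivative_X_pow, derivative_one,
      derivative_X, derivative_natCast, derivative_ofNat, Nat.cast_ofNat, map_ofNat,
      ← Function.iterate_succ_apply' derivative] at h
    push_cast
    linear_combination h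

theorem legendreOperator_legendrePoly (c : ℝ) (n : ℕ) :
    legendreOperator c (legendrePoly n) = ((n : ℝ) * (n + 1) + c) • legendrePoly n := by
  have hu : (X ^ 2 - 1) * derivative ((X ^ 2 - 1 : ℝ[X]) ^ n) =
      2 * (n : ℝ[X]) * X * (X ^ 2 - 1) ^ n := by
    cases n with
    | zero => simp
    | succ n =>
      rw [derivative_pow_succ]
      simp only [derivative_sub, derivative_X_pow, derivative_one, map_add, map_natCast, map_one,
        Nat.cast_ofNat, map_ofNat]
      push_cast
      ring
  have h := iterate_derivative_of_sq_sub_one_mul_derivative hu n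
  simp only [Function.iterate_succ_apply'] at h
  rw [legendreOperator_apply, legendrePoly, derivative_C_mul, derivative_C_mul, smul_eq_C_mul]
  simp only [map_mul, map_add, map_natCast, map_one]
  linear_combination (C (1 / (2 ^ n * (n.factorial : ℝ)))) * h

theorem IsHyperbolic.const_smul {f : ℝ[X]} (hf : IsHyperbolic f) (a : ℝ) :
    IsHyperbolic (a • f) := by
  rcases eq_or_ne a 0 with rfl | ha
  · left; simp
  · rcases hf with rfl | hf
    · left; simp
    · right
      intro z hz
      refine hf z ?_
      rw [map_smul] at hz
      exact (smul_eq_zero.mp hz).resolve_left ha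

theorem isMultiplierSequence_legendreBasis_iff {A : ℝ} (hA : A ≠ 0) (B : ℝ) :
    IsMultiplierSequence legendreBasis (fun n : ℕ => A * (n : ℝ) * ((n : ℝ) + 1) + B) ↔
      PreservesHyperbolicity (legendreOperator (B / A)) := by
  have key : ∀ n : ℕ, (A • legendreOperator (B / A)) (legendreBasis n) =
      (A * (n : ℝ) * ((n : ℝ) + 1) + B) • legendreBasis n := fun n => by
    rw [LinearMap.smul_apply, legendreBasis_apply, legendreOperator_legendrePoly, smul_smul]
    congr 1
    field_simp
  constructor
  · rintro ⟨T, hT, h⟩ f hf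
    have hTA : T = A • legendreOperator (B / A) :=
      legendreBasis.ext fun n => (h n).trans (key n).symm
    have := (hT f hf).const_smul A⁻¹
    rwa [hTA, LinearMap.smul_apply, inv_smul_smul₀ hA] at this
  · exact fun h => ⟨_, fun f hf => (h f hf).const_smul A, key⟩

/-! ### Sufficiency -/

theorem im_nonneg_of_legendre_symbol_eq_zero {c : ℝ} (h0 : 0 ≤ c) (h1 : c ≤ 1) {z y : ℂ}
    (hz : 0 < z.im) (h : (z ^ 2 - 1) * y ^ 2 + 2 * z * y + c = 0) : 0 ≤ y.im := by
  by_contra! hy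
  have hy0 : y ≠ 0 := by rintro rfl; simp at hy
  obtain ⟨w, rfl⟩ : ∃ w : ℂ, y = w⁻¹ := ⟨y⁻¹, by simp⟩
  have hw0 : w ≠ 0 := by rintro rfl; simp at hy0
  have hw : 0 < w.im := by
    rw [Complex.inv_im, div_neg_iff] at hy
    rcases hy with ⟨_, h⟩ | ⟨h, _⟩
    · exact absurd h (not_lt.mpr (Complex.normSq_nonneg _))
    · linarith
  -- Completing the square. With `s = z + w` and `d = 1 - c`, imaginary parts give `|Re s| ≤ d |Re
  -- w|`; as `Im s > Im w`, `Re s²` is then too small to equal `1 + d Re w²`.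
  have hs : (z + w) ^ 2 = 1 + ((1 - c : ℝ) : ℂ) * w ^ 2 := by
    field_simp at h
    push_cast
    linear_combination h
  generalize hs' : z + w = s at hs
  have hq : w.im < s.im := by rw [← hs', Complex.add_im]; linarith
  have hre := congrArg Complex.re hs
  have him := congrArg Complex.im hs
  simp only [pow_two, Complex.mul_re, Complex.mul_im, Complex.add_re, Complex.add_im,
    Complex.one_re, Complex.one_im, Complex.ofReal_re, Complex.ofReal_im] at hre him
  set d := 1 - c with hd
  have hd0 : 0 ≤ d := by linarith
  have hd1 : d ≤ 1 := by linarith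
  have hpq : s.re * s.im = d * w.re * w.im := by linarith
  have hp : |s.re| ≤ d * |w.re| := by
    have : |s.re| * s.im = d * |w.re| * w.im := by
      have := congrArg abs hpq
      rwa [abs_mul, abs_mul, abs_mul, abs_of_pos hw, abs_of_pos (hw.trans hq),
        abs_of_nonneg hd0] at this
    by_contra! hlt
    have : d * |w.re| * w.im < |s.re| * s.im :=
      mul_lt_mul'' hlt hq (by positivity) hw.le
    linarith
  have hp2 : s.re ^ 2 ≤ d ^ 2 * w.re ^ 2 := by
    have := pow_le_pow_left₀ (abs_nonneg _) hp 2
    rwa [mul_pow, sq_abs, sq_abs] at this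
  have hq2 : w.im ^ 2 < s.im ^ 2 := pow_lt_pow_left₀ hq hw.le two_ne_zero
  have h3 : d ^ 2 * w.re ^ 2 ≤ d * w.re ^ 2 :=
    mul_le_mul_of_nonneg_right (by nlinarith) (sq_nonneg _)
  have h4 : d * w.im ^ 2 ≤ w.im ^ 2 := mul_le_of_le_one_left (sq_nonneg _) hd1
  nlinarith

/-- If a nonconstant polynomial has no zeros in the upper half plane, then neither has
`f' - α f` for `0 ≤ Im α`. -/
theorem eval_derivative_sub_mul_ne_zero {f : ℂ[X]} (hdeg : 0 < f.natDegree)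
    (hf : ∀ z : ℂ, 0 < z.im → f.eval z ≠ 0) {α : ℂ} (hα : 0 ≤ α.im) {z : ℂ} (hz : 0 < z.im) :
    (derivative f - C α * f).eval z ≠ 0 := by
  have hfz := hf z hz
  have hs : f.Splits := IsAlgClosed.splits f
  have hsum : (derivative f).eval z / f.eval z = (f.roots.map fun r => 1 / (z - r)).sum := by
    exact hs.eval_derivative_div_eval_of_ne_zero hfz
  have hroots : f.roots ≠ 0 := by
    intro h
    have := hs.natDegree_eq_card_roots
    rw [h] at this
    simp at this; omega
  -- Each `z - r` lies in the upper half plane, so its inverse lies in the lower one.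
  have him : ((f.roots.map fun r => 1 / (z - r)).sum).im < 0 := by
    rw [← Complex.coe_imAddGroupHom, map_multiset_sum, Multiset.map_map]
    have : (f.roots.map fun r => (Complex.imAddGroupHom ∘ fun r => 1 / (z - r)) r).sum <
        (f.roots.map fun _ => (0 : ℝ)).sum := by
      refine Multiset.sum_lt_sum_of_nonempty hroots fun r hr => ?_
      have hr' : r.im ≤ 0 := by
        by_contra! h
        exact hf r h (isRoot_of_mem_roots hr)
      have hne : z - r ≠ 0 := by
        intro h
        have := congrArg Complex.im h
        simp at this; linarith
      simp only [Function.comp_apply, Complex.coe_imAddGroupHom, one_div, Complex.inv_im]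
      refine div_neg_of_neg_of_pos ?_ (Complex.normSq_pos.mpr hne)
      rw [Complex.sub_im]; linarith
    simpa using this
  intro h
  rw [eval_sub, eval_mul, eval_C, sub_eq_zero] at h
  rw [← hsum, h, mul_div_cancel_right₀ _ hfz] at him
  linarith

theorem eval_legendre_symbol_ne_zero {c : ℝ} (h0 : 0 ≤ c) (h1 : c ≤ 1) {f : ℂ[X]}
    (hdeg : 0 < f.natDegree) (hf : ∀ z : ℂ, 0 < z.im → f.eval z ≠ 0) {z : ℂ} (hz : 0 < z.im) :
    (z ^ 2 - 1) * (derivative (derivative f)).eval z + 2 * z * (derivative f).eval z +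
      c * f.eval z ≠ 0 := by
  have hz0 : z ≠ 0 := by rintro rfl; simp at hz
  have ha : z ^ 2 - 1 ≠ 0 := by
    intro h
    rcases sq_eq_sq_iff_eq_or_eq_neg.mp ((sub_eq_zero.mp h).trans (one_pow 2).symm) with
      rfl | rfl <;> simp at hz
  -- A nonzero root keeps `f' - α f` nonconstant, as the second factor requires; for `c = 0` one
  -- root vanishes.
  obtain ⟨α, hα, hα0⟩ : ∃ α : ℂ, (z ^ 2 - 1) * α ^ 2 + 2 * z * α + c = 0 ∧ α ≠ 0 := by
    obtain ⟨s, hs⟩ := IsAlgClosed.exists_pow_nat_eq (z ^ 2 - (z ^ 2 - 1) * c) two_pos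
    have h1 : ∀ t : ℂ, t ^ 2 = s ^ 2 →
        (z ^ 2 - 1) * ((-z + t) / (z ^ 2 - 1)) ^ 2 + 2 * z * ((-z + t) / (z ^ 2 - 1)) + c = 0 := by
      intro t ht
      rw [hs] at ht
      field_simp
      linear_combination ht
    by_cases h : -z + s = 0
    · refine ⟨_, h1 (-s) (neg_sq s), div_ne_zero ?_ ha⟩
      intro h'
      exact hz0 (by linear_combination -(h + h') / 2)
    · exact ⟨_, h1 s rfl, div_ne_zero h ha⟩
  set β : ℂ := -2 * z / (z ^ 2 - 1) - α with hβdef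
  have hsum : (z ^ 2 - 1) * (α + β) = -2 * z := by rw [hβdef]; field_simp; ring
  have hprod : (z ^ 2 - 1) * (α * β) = c := by linear_combination α * hsum - hα
  have hβ : (z ^ 2 - 1) * β ^ 2 + 2 * z * β + c = 0 := by linear_combination β * hsum - hprod
  have hαi := im_nonneg_of_legendre_symbol_eq_zero h0 h1 hz hα
  have hβi := im_nonneg_of_legendre_symbol_eq_zero h0 h1 hz hβ
  have hg : ∀ w : ℂ, 0 < w.im → (derivative f - C α * f).eval w ≠ 0 := fun w hw =>
    eval_derivative_sub_mul_ne_zero hdeg hf hαi hw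
  have hgdeg : 0 < (derivative f - C α * f).natDegree := by
    rw [natDegree_sub_eq_right_of_natDegree_lt, natDegree_C_mul hα0]
    · exact hdeg
    · rw [natDegree_C_mul hα0]; exact natDegree_derivative_lt hdeg.ne'
  have key := eval_derivative_sub_mul_ne_zero hgdeg hg hβi hz
  intro h
  refine mul_ne_zero ha key ?_
  simp only [eval_sub, eval_mul, eval_C, derivative_sub, derivative_C_mul]
  linear_combination h - (derivative f).eval z * hsum + f.eval z * hprod

theorem IsHyperbolic.of_natDegree_eq_zero {f : ℝ[X]} (hf : f.natDegree = 0) : IsHyperbolic f := by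
  obtain ⟨a, rfl⟩ := natDegree_eq_zero.mp hf
  rcases eq_or_ne a 0 with rfl | ha
  · left; simp
  · right
    intro z hz
    simp [ha] at hz

theorem preservesHyperbolicity_legendreOperator {c : ℝ} (h0 : 0 ≤ c) (h1 : c ≤ 1) :
    PreservesHyperbolicity (legendreOperator c) := by
  intro f hf
  by_cases hdeg : f.natDegree = 0
  · refine IsHyperbolic.of_natDegree_eq_zero ?_
    obtain ⟨a, rfl⟩ := natDegree_eq_zero.mp hdeg
    rw [legendreOperator_apply, derivative_C, derivative_zero, mul_zero, mul_zero, zero_add,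
      zero_add, ← C_mul, natDegree_C]
  have hf' : ∀ z : ℂ, aeval z f = 0 → z.im = 0 := by
    rcases hf with rfl | hf
    · simp at hdeg
    · exact hf
  right
  have upper : ∀ z : ℂ, 0 < z.im → aeval z (legendreOperator c f) ≠ 0 := by
    intro z hz
    have := eval_legendre_symbol_ne_zero h0 h1 (f := f.map (algebraMap ℝ ℂ))
      (by rw [natDegree_map]; omega)
      (fun w hw h => hw.ne' (hf' w (by rwa [eval_map_algebraMap] at h))) hz
    rw [derivative_map, derivative_map, eval_map_algebraMap, eval_map_algebraMap,
      eval_map_algebraMap] at this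
    simpa [legendreOperator_apply, map_ofNat] using this
  intro z hz
  rcases lt_trichotomy z.im 0 with h | h | h
  · refine absurd ?_ (upper (starRingEnd ℂ z) (by simpa using h))
    rw [aeval_conj, hz, map_zero]
  · exact h
  · exact absurd hz (upper z h)

/-! ### Necessity -/

theorem isHyperbolic_X_sub_C_pow (r : ℝ) (n : ℕ) : IsHyperbolic ((X - C r) ^ n) := by
  right
  intro z hz
  rw [map_pow] at hz
  have := eq_zero_of_pow_eq_zero hz
  simp only [map_sub, aeval_X, aeval_C, sub_eq_zero] at this
  rw [this]; simp

theorem IsHyperbolic.mul {f g : ℝ[X]} (hf : IsHyperbolic f) (hg : IsHyperbolic g) :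
    IsHyperbolic (f * g) := by
  rcases hf with rfl | hf
  · left; simp
  rcases hg with rfl | hg
  · left; simp
  right
  intro z hz
  rw [map_mul, mul_eq_zero] at hz
  exact hz.elim (hf z) (hg z)

theorem isHyperbolic_X_sq_sub_C_sq (r : ℝ) : IsHyperbolic (X ^ 2 - C (r ^ 2)) := by
  have := (isHyperbolic_X_sub_C_pow r 1).mul (isHyperbolic_X_sub_C_pow (-r) 1)
  convert this using 1
  simp only [map_neg, map_pow]
  ring

/-- A polynomial divisible by a quadratic of negative discriminant is hyperbolic only if zero. -/
theorem not_isHyperbolic_mul_quadratic {g : ℝ[X]} (hg : g ≠ 0) {a b c : ℝ} (ha : a ≠ 0)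
    (h : b ^ 2 < a * c) : ¬ IsHyperbolic (g * (C a * X ^ 2 + C (2 * b) * X + C c)) := by
  have hev : ∃ z : ℂ, z.im ≠ 0 ∧
      aeval z (C a * X ^ 2 + C (2 * b) * X + C c : ℝ[X]) = 0 := by
    set s := √(a * c - b ^ 2) with hs
    have hs2 : s ^ 2 = a * c - b ^ 2 := Real.sq_sqrt (by linarith)
    have hs0 : s ≠ 0 := (Real.sqrt_pos.mpr (by linarith)).ne'
    refine ⟨⟨-b / a, s / a⟩, div_ne_zero hs0 ha, ?_⟩
    simp only [map_add, map_mul, map_pow, aeval_X, aeval_C, Complex.coe_algebraMap]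
    apply Complex.ext
    · simp [pow_two]
      field_simp
      linear_combination -hs2
    · simp [pow_two]
      field_simp
      ring
  obtain ⟨z, hz, hz0⟩ := hev
  rintro (h0 | h0)
  · rcases mul_eq_zero.mp h0 with h1 | h1
    · exact hg h1
    · have := congrArg (fun p : ℝ[X] => p.coeff 2) h1
      simp [ha] at this
  · exact hz (h0 z (by rw [map_mul, hz0, mul_zero]))

theorem legendreOperator_X_sub_C_pow (c r : ℝ) (m : ℕ) :
    legendreOperator c ((X - C r) ^ (m + 2)) =
      (X - C r) ^ m * (C ((m + 2) * (m + 3) + c) * X ^ 2 + C (2 * (-(m + 2 + c) * r)) * X +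
        C (c * r ^ 2 - (m + 2) * (m + 1))) := by
  simp only [legendreOperator_apply, derivative_pow_succ, derivative_mul, derivative_sub,
    derivative_X, derivative_C, derivative_one, derivative_natCast, C_add, C_mul, C_sub,
    C_neg, C_pow, map_natCast, map_ofNat, map_one, Nat.cast_add, Nat.cast_one, derivative_add,
    sub_zero]
  ring

theorem le_one_of_preservesHyperbolicity {c : ℝ}
    (h : PreservesHyperbolicity (legendreOperator c)) : c ≤ 1 := by
  by_contra! hc
  obtain ⟨m, hm⟩ := exists_nat_gt (1 / (c - 1))
  have hm' : 1 < m * (c - 1) := (div_lt_iff₀ (by linarith)).mp hm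
  have hm0 : (0 : ℝ) ≤ m := Nat.cast_nonneg m
  -- The discriminant condition on the quadratic factor is `(m + 2)(r² δ - N) > 0`.
  set δ : ℝ := c * (m + 1) - (m + 2) with hδdef
  have hδ : 0 < δ := by nlinarith
  set N : ℝ := (m + 1) * ((m + 2) * (m + 3) + c) with hN
  have hN0 : 0 ≤ N := by positivity
  set r : ℝ := N / δ + 1 with hr
  have hr1 : 1 ≤ r := by rw [hr]; have := div_nonneg hN0 hδ.le; linarith
  have hrN : N < r ^ 2 * δ := by
    have : N < r * δ := by rw [hr, add_mul, div_mul_cancel₀ _ hδ.ne']; linarith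
    nlinarith
  have := h _ (isHyperbolic_X_sub_C_pow r (m + 2))
  rw [legendreOperator_X_sub_C_pow] at this
  refine not_isHyperbolic_mul_quadratic (pow_ne_zero _ (X_sub_C_ne_zero r)) (by positivity) ?_ this
  have := mul_pos (by positivity : (0 : ℝ) < m + 2) (sub_pos.mpr hrN)
  rw [hδdef, hN] at this
  linear_combination this

theorem legendreOperator_X_sq_sub_C (c r : ℝ) :
    legendreOperator c (X ^ 2 - C r) =
      1 * (C (6 + c) * X ^ 2 + C (2 * 0) * X + C (-2 - c * r)) := by
  simp only [legendreOperator_apply, derivative_X_sq, derivative_mul, derivative_sub,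
    derivative_X, derivative_C, derivative_ofNat, sub_zero, C_add, C_mul, C_sub, C_neg, map_ofNat,
    map_zero]
  ring

theorem legendreOperator_sub_six_cubic (r : ℝ) :
    legendreOperator (-6) (X * (X ^ 2 - C r)) =
      X * (C 6 * X ^ 2 + C (2 * 0) * X + C (4 * r - 6)) := by
  simp only [legendreOperator_apply, derivative_X_sq, derivative_mul, derivative_sub, derivative_add,
    derivative_X, derivative_C, derivative_one, derivative_ofNat, C_mul, C_sub, C_neg, map_ofNat,
    map_zero]
  ring

theorem nonneg_of_preservesHyperbolicity {c : ℝ}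
    (h : PreservesHyperbolicity (legendreOperator c)) : 0 ≤ c := by
  by_contra! hc
  rcases lt_trichotomy c (-6) with h6 | rfl | h6
  · have := h _ (isHyperbolic_X_sq_sub_C_sq 0)
    rw [legendreOperator_X_sq_sub_C] at this
    exact not_isHyperbolic_mul_quadratic one_ne_zero (by linarith) (by nlinarith) this
  -- At `c = -6` the image of `x² - r²` loses its leading term, hence the cubic `x(x² - 4)`.
  · have := h _ ((isHyperbolic_X_sub_C_pow 0 1).mul (isHyperbolic_X_sq_sub_C_sq 2))
    rw [map_zero, sub_zero, pow_one, legendreOperator_sub_six_cubic] at this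
    exact not_isHyperbolic_mul_quadratic X_ne_zero (by norm_num) (by norm_num) this
  -- Chosen so that `r ≥ 1` and `c r = c - 2`, whence `c r² < -2`.
  · set r : ℝ := 1 - 2 / c with hr
    have h2 : 0 < -2 / c := div_pos_of_neg_of_neg (by norm_num) hc
    have hr1 : 1 ≤ r := by rw [hr, sub_eq_add_neg, ← neg_div]; linarith
    have hcr : c * r = c - 2 := by rw [hr, mul_sub, mul_one, mul_div_cancel₀ _ hc.ne]
    have hlt : 0 < -2 - c * r ^ 2 := by nlinarith
    have := h _ (isHyperbolic_X_sq_sub_C_sq r)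
    rw [legendreOperator_X_sq_sub_C] at this
    refine not_isHyperbolic_mul_quadratic one_ne_zero (by linarith) ?_ this
    rw [zero_pow two_ne_zero]
    exact mul_pos (by linarith) hlt

end

theorem mainTheorem10 (A B : ℝ) (hA : A ≠ 0) :
    IsMultiplierSequence legendreBasis (fun n : ℕ => A * (n : ℝ) * ((n : ℝ) + 1) + B) ↔
      0 ≤ B / A ∧ B / A ≤ 1 := by
  rw [isMultiplierSequence_legendreBasis_iff hA]
  exact ⟨fun h => ⟨nonneg_of_preservesHyperbolicity h, le_one_of_preservesHyperbolicity h⟩,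
    fun h => preservesHyperbolicity_legendreOperator h.1 h.2⟩
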